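/- Let $n\ge 0$ and $t,u,v\in\mathbb C$. Let $\mathcal C[\xi_1,\dots,\xi_n]$ be the skew-polynomial algebra, i.e. the unital $\mathbb C$-algebra generated by $\xi_1,\dots,\xi_n$ with relations $\xi_i\xi_j=-\xi_j\xi_i$ for $i\neq j$. Let $W$ be one of $W_{A_{n-1}}=S_n$, $W_{B_n}$ (all signed permutations of $1,\dots,n$), or $W_{D_n}$ (signed permutations with an even number of sign changes), let $s_{ij}$ be the transposition of $i$ and $j$, $\overline s_{ij}$ the transposition of $i$ and $j$ coupled with the sign changes at $i$ and $j$, and $\tau_i$ the sign change at $i$; let $\sigma\mapsto\sigma^*$ be the homomorphism $W\to S_n$ that forgets signs. Let $f\mapsto f^{w}$ be the natural action of $w\in W_{B_n}$ on $\mathcal C[\xi_1,\dots,\xi_n]$ by algebra automorphisms (permuting the $\xi_j$ with signs). The odd double affine Hecke algebra $\ddot{\mathfrak H}^{\rm odd}_W$ is the $\mathbb C$-algebra generated by $\xi_i,\eta_i$ $(1\le i\le n)$ and $\mathbb C W$, with relations $\eta_i\eta_j=-\eta_j\eta_i$, $\xi_i\xi_j=-\xi_j\xi_i$ $(i\ne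 j)$, $\sigma\xi_j=\xi_{\sigma^*(j)}\sigma$, $\sigma\eta_j=\eta_{\sigma^*(j)}\sigma$ $(\sigma\in W)$ and, with $[a,b]_+=ab+ba$ and $i\neq j$: - type A: $[\eta_i,\xi_j]_+=u\,s_{ij}$, $\ [\eta_i,\xi_i]_+=t+u\sum_{k\ne i}s_{ki}$; - type D: $[\eta_i,\xi_j]_+=u(s_{ij}+\overline s_{ij})$, $\ [\eta_i,\xi_i]_+=t+u\sum_{k\ne i}(s_{ki}+\overline s_{ki})$; - type B: $[\eta_i,\xi_j]_+=u(s_{ij}+\overline s_{ij})$, $\ [\eta_i,\xi_i]_+=t+u\sum_{k\ne i}(s_{ki}+\overline s_{ki})+v\,\tau_i$. Let $\mathfrak h_\eta$ be the subalgebra generated by the $\eta_i$ and $\mathbb C W$. Then the trivial one-dimensional $\mathbb CW$-module $V$ extends (uniquely) to an $\mathfrak h_\eta$-module on which every $\eta_i$ acts as $0$. The map $f\mapsto f\otimes 1$ is a linear isomorphism from $\mathcal C[\xi_1,\dots,\xi_n]$ onto $\mathrm{Ind}_{\mathfrak h_\eta}^{\ddot{\mathfrak H}^{\rm odd}_W}V$.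 Under this identification $\sigma\in W$ acts by the permutation $\sigma^*$ of the indices, $\xi_i$ acts by left multiplication, and $\eta_i$ acts by the following Dunkl operators, which satisfy $\eta_i\eta_j=-\eta_j\eta_i$ for $i\neq j$: - type A: $\displaystyle \eta_i=t\,\partial_{\xi_i}+u\sum_{k\neq i}\frac{1}{\xi_i^2-\xi_k^2}\bigl((\xi_i-\xi_k)s_{ik}-(\xi_i\tau_i-\xi_k\tau_k)\bigr)$; - type B: $\displaystyle \eta_i=t\,\partial_{\xi_i}+v\,\frac{1-\tau_i}{2\xi_i}+u\sum_{k\neq i}\frac{2}{\xi_i^2-\xi_k^2}\bigl((\xi_i-\xi_k)s_{ik}-(\xi_i\tau_i-\xi_k\tau_k)\bigr)$; - type D: $\displaystyle \eta_i=t\,\partial_{\xi_i}+u\sum_{k\neq i}\frac{2}{\xi_i^2-\xi_k^2}\bigl((\xi_i-\xi_k)s_{ik}-(\xi_i\tau_i-\xi_k\tau_k)\bigr)$. Here $s_{ik}$ and $\tau_i$ in the operators denote the natural action $f\mapsto f^{s_{ik}}$, $f\mapsto f^{\tau_i}$; $\partial_{\xi_i}$ is the odd derivation, the linear map with $\partial_{\xi_i}(\xi_{a_1}\cdots\xi_{a_l})=\sum_k(-1)^{k-1}\delta_{i,a_k}\,\xi_{a_1}\cdots\xi_{a_{k-1}}\xi_{a_{k+1}}\cdots\xi_{a_l}$;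 and $\frac1g h$ is the unique $q\in\mathcal C[\xi_1,\dots,\xi_n]$ with $gq=h$, which exists for each quotient that occurs above. -/

import Mathlib

namespace OddDaha

open scoped TensorProduct

noncomputable section

/-! ### The skew-polynomial algebra -/

/-- The relations `ξ_i ξ_j = -ξ_j ξ_i` for `i ≠ j`. -/
inductive SkewRel (n : ℕ) : FreeAlgebra ℂ (Fin n) → FreeAlgebra ℂ (Fin n) → Prop
  | anti (i j : Fin n) (h : i ≠ j) :
      SkewRel n (FreeAlgebra.ι ℂ i * FreeAlgebra.ι ℂ j)
        (-(FreeAlgebra.ι ℂ j * FreeAlgebra.ι ℂ i))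

/-- The skew-polynomial algebra `C[ξ_1, …, ξ_n]`. -/
def Skew (n : ℕ) : Type := RingQuot (SkewRel n)

instance (n : ℕ) : Ring (Skew n) := inferInstanceAs (Ring (RingQuot (SkewRel n)))

instance (n : ℕ) : Algebra ℂ (Skew n) := inferInstanceAs (Algebra ℂ (RingQuot (SkewRel n)))

/-- The quotient map from the free algebra. -/
def skewMk (n : ℕ) : FreeAlgebra ℂ (Fin n) →ₐ[ℂ] Skew n := RingQuot.mkAlgHom ℂ (SkewRel n)

/-- The generator `ξ_i` of the skew-polynomial algebra. -/
def xi {n : ℕ} (i : Fin n) : Skew n :=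
  skewMk n (FreeAlgebra.ι ℂ i)

theorem xi_anti {n : ℕ} {i j : Fin n} (h : i ≠ j) :
    (xi i : Skew n) * xi j = -(xi j * xi i) := by
  have h1 : skewMk n _ = skewMk n _ := RingQuot.mkAlgHom_rel ℂ (SkewRel.anti i j h)
  simpa only [xi, map_mul, map_neg] using h1

/-- The universal property of the skew-polynomial algebra. -/
def skewLift {n : ℕ} {A : Type*} [Ring A] [Algebra ℂ A] (x : Fin n → A)
    (hx : ∀ i j, i ≠ j → x i * x j = -(x j * x i)) : Skew n →ₐ[ℂ] A :=
  RingQuot.liftAlgHom ℂ ⟨FreeAlgebra.lift ℂ x, by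
    rintro _ _ ⟨i, j, h⟩
    simpa using hx i j h⟩

@[simp]
theorem skewLift_xi {n : ℕ} {A : Type*} [Ring A] [Algebra ℂ A] (x : Fin n → A)
    (hx : ∀ i j, i ≠ j → x i * x j = -(x j * x i)) (i : Fin n) :
    skewLift x hx (xi i) = x i :=
  (RingQuot.liftAlgHom_mkAlgHom_apply ℂ _ _ _).trans (FreeAlgebra.lift_ι_apply x i)

/-! ### The odd derivation -/

/-- The algebra homomorphism to upper triangular matrices whose upper right entry is the odd
derivation with respect to `ξ_i`. -/
def oddPartialHom {n : ℕ} (i : Fin n) : Skew n →ₐ[ℂ] Matrix (Fin 2) (Fin 2) (Skew n) :=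
  skewLift (fun j => !![-xi j, if i = j then 1 else 0; 0, xi j]) (by
    intro j k h
    have h1 := xi_anti h
    by_cases hj : i = j <;> by_cases hk : i = k <;> simp_all)

/-- The odd derivation `∂_{ξ_i}` of the skew-polynomial algebra. -/
def oddPartial {n : ℕ} (i : Fin n) (f : Skew n) : Skew n := oddPartialHom i f 0 1

theorem oddPartialHom_lower {n : ℕ} (i : Fin n) (l : List (Fin n)) :
    oddPartialHom i (l.map xi).prod 1 1 = (l.map xi).prod := by
  induction l with
  | nil => simp
  | cons j l ih =>
    have h1 : oddPartialHom i (xi j) = !![-xi j, if i = j then 1 else 0; 0, xi j] :=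
      skewLift_xi _ _ j
    rw [List.map_cons, List.prod_cons, map_mul, Matrix.mul_apply, Fin.sum_univ_two, ih, h1]
    simp

/-- The defining formula of `∂_{ξ_i}` on monomials (it is additive and homogeneous by
construction). -/
theorem oddPartial_prod {n : ℕ} (i : Fin n) (l : List (Fin n)) :
    oddPartial i (l.map xi).prod =
      ∑ k : Fin l.length, (-1 : ℂ) ^ (k : ℕ) •
        (((l.take k).map xi).prod * (if i = l.get k then 1 else 0) *
          ((l.drop (k + 1)).map xi).prod) := by
  induction l with
  | nil => simp [oddPartial]
  | cons j l ih =>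
    have h0 : oddPartial i ((j :: l).map xi).prod
        = -(xi j * oddPartial i (l.map xi).prod)
          + (if i = j then 1 else 0) * (l.map xi).prod := by
      have h1 : oddPartialHom i (xi j) = !![-xi j, if i = j then 1 else 0; 0, xi j] :=
        skewLift_xi _ _ j
      simp only [oddPartial, List.map_cons, List.prod_cons, map_mul, h1]
      rw [Matrix.mul_apply, Fin.sum_univ_two, oddPartialHom_lower]
      simp
    rw [h0, ih]
    simp only [List.length_cons]
    rw [Fin.sum_univ_succ, Finset.mul_sum, add_comm, ← Finset.sum_neg_distrib]
    congr 1
    · by_cases hj : i = j <;> simp [hj]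
    · refine Finset.sum_congr rfl fun k _ => ?_
      by_cases hk : i = l[(k : ℕ)] <;> simp [hk, pow_succ, mul_assoc]

/-! ### Left division

In the skew-polynomial algebra `(1/g) · f` denotes the element `q` with `g q = f`. -/

open Classical in
/-- `(1/g) · f`: the element `q` with `g * q = f` if there is one (and `0` otherwise). -/
def leftQuot {n : ℕ} (g f : Skew n) : Skew n :=
  if h : ∃ q, g * q = f then h.choose else 0

/-! ### The classical Weyl groups as groups of signed permutations -/

/-- The group `W_{B_n}` of signed permutations `(ε, π)`, acting by `e_j ↦ ε_{π j} e_{π j}`. -/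
abbrev WB (n : ℕ) : Type := (Fin n → ℤˣ) ⋊[mulAutArrow] Equiv.Perm (Fin n)

/-- The homomorphism `σ ↦ σ^*` to the symmetric group that forgets the signs. -/
def rhoB (n : ℕ) : WB n →* Equiv.Perm (Fin n) := SemidirectProduct.rightHom

/-- The transposition `s_{ij}`. -/
def sB {n : ℕ} (i j : Fin n) : WB n := ⟨1, Equiv.swap i j⟩

/-- The transposition of `i` and `j` coupled with the sign changes at `i` and `j`. -/
def sbarB {n : ℕ} (i j : Fin n) : WB n :=
  ⟨Pi.mulSingle i (-1) * Pi.mulSingle j (-1), Equiv.swap i j⟩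

/-- The sign change `τ_i` at `i`. -/
def tauB {n : ℕ} (i : Fin n) : WB n := ⟨Pi.mulSingle i (-1), 1⟩

/-- The group `W_{D_n}` of even signed permutations. -/
def WD (n : ℕ) : Subgroup (WB n) where
  carrier := {w | ∏ i, w.left i = 1}
  one_mem' := by simp
  mul_mem' := by
    intro a b ha hb
    simp only [Set.mem_ofPred_eq] at *
    simp only [SemidirectProduct.mul_left, Pi.mul_apply, Finset.prod_mul_distrib, ha, one_mul]
    rw [← hb]
    exact Equiv.prod_comp (a.right⁻¹ : Equiv.Perm (Fin n)) b.left
  inv_mem' := by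
    intro a ha
    simp only [Set.mem_ofPred_eq] at *
    have h : ∏ i, (a⁻¹).left i = ∏ i, (a.left⁻¹) i :=
      Equiv.prod_comp ((a.right⁻¹)⁻¹ : Equiv.Perm (Fin n)) (a.left⁻¹)
    rw [h]
    simp [ha]

theorem sB_mem {n : ℕ} (i j : Fin n) : sB i j ∈ WD n := by
  show ∏ k, (1 : Fin n → ℤˣ) k = 1
  simp

theorem sbarB_mem {n : ℕ} (i j : Fin n) : sbarB i j ∈ WD n := by
  show ∏ k, (Pi.mulSingle i (-1) * Pi.mulSingle j (-1) : Fin n → ℤˣ) k = 1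
  simp [Finset.prod_mul_distrib]

/-- `s_{ij}` as an element of `W_{D_n}`. -/
def sD {n : ℕ} (i j : Fin n) : WD n := ⟨sB i j, sB_mem i j⟩

/-- `\bar s_{ij}` as an element of `W_{D_n}`. -/
def sbarD {n : ℕ} (i j : Fin n) : WD n := ⟨sbarB i j, sbarB_mem i j⟩

/-- The restriction of `σ ↦ σ^*` to `W_{D_n}`. -/
def rhoD (n : ℕ) : WD n →* Equiv.Perm (Fin n) := (rhoB n).comp (WD n).subtype

/-- The natural action `f ↦ f^w` of signed permutations on the skew-polynomial algebra by
algebra automorphisms: `ξ_j ↦ ε_{π j} ξ_{π j}` for `w = (ε, π)`. -/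
def act {n : ℕ} (w : WB n) : Skew n →ₐ[ℂ] Skew n :=
  skewLift (fun j => (((w.left (w.right j) : ℤˣ) : ℤ) : ℂ) • xi (w.right j)) (by
    intro i j h
    have h1 := xi_anti (w.right.injective.ne h)
    simp only [smul_mul_smul_comm, h1, smul_neg]
    rw [mul_comm])

/-- The action of a permutation by permuting the indices. -/
def permAct {n : ℕ} (π : Equiv.Perm (Fin n)) : Skew n →ₐ[ℂ] Skew n := act ⟨1, π⟩

/-! ### The odd double affine Hecke algebras -/

/-- The generators `ξ_i`, `η_i` and `σ ∈ G`. -/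
inductive HOGen (n : ℕ) (G : Type) : Type
  | xi (i : Fin n) : HOGen n G
  | eta (i : Fin n) : HOGen n G
  | grp (g : G) : HOGen n G

/-- The free generator attached to `ξ_i`. -/
abbrev fXi {n : ℕ} (G : Type) (i : Fin n) : FreeAlgebra ℂ (HOGen n G) :=
  FreeAlgebra.ι ℂ (HOGen.xi i)

/-- The free generator attached to `η_i`. -/
abbrev fEta {n : ℕ} (G : Type) (i : Fin n) : FreeAlgebra ℂ (HOGen n G) :=
  FreeAlgebra.ι ℂ (HOGen.eta i)

/-- The free generator attached to `g ∈ G`. -/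
abbrev fGrp (n : ℕ) {G : Type} (g : G) : FreeAlgebra ℂ (HOGen n G) :=
  FreeAlgebra.ι ℂ (HOGen.grp g)

/-- The relations common to the odd double affine Hecke algebras of all types, together with
`[η_i, ξ_j]_+ = κ_{ij}`, where `κ_{ij}` depends on the type. -/
inductive HORel {n : ℕ} {G : Type} [Group G] (ρ : G →* Equiv.Perm (Fin n))
    (κ : Fin n → Fin n → FreeAlgebra ℂ (HOGen n G)) :
    FreeAlgebra ℂ (HOGen n G) → FreeAlgebra ℂ (HOGen n G) → Prop
  | grp_one : HORel ρ κ (fGrp n (1 : G)) 1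
  | grp_mul (g h : G) : HORel ρ κ (fGrp n (g * h)) (fGrp n g * fGrp n h)
  | eta_eta (i j : Fin n) (h : i ≠ j) :
      HORel ρ κ (fEta G i * fEta G j) (-(fEta G j * fEta G i))
  | xi_xi (i j : Fin n) (h : i ≠ j) :
      HORel ρ κ (fXi G i * fXi G j) (-(fXi G j * fXi G i))
  | grp_xi (g : G) (j : Fin n) : HORel ρ κ (fGrp n g * fXi G j) (fXi G (ρ g j) * fGrp n g)
  | grp_eta (g : G) (j : Fin n) : HORel ρ κ (fGrp n g * fEta G j) (fEta G (ρ g j) * fGrp n g)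
  | eta_xi (i j : Fin n) : HORel ρ κ (fEta G i * fXi G j + fXi G j * fEta G i) (κ i j)

/-- The algebra generated by `ξ_i`, `η_i` and `ℂ G` subject to the relations `HORel`. -/
def HO {n : ℕ} {G : Type} [Group G] (ρ : G →* Equiv.Perm (Fin n))
    (κ : Fin n → Fin n → FreeAlgebra ℂ (HOGen n G)) : Type :=
  RingQuot (HORel ρ κ)

instance {n : ℕ} {G : Type} [Group G] (ρ : G →* Equiv.Perm (Fin n))
    (κ : Fin n → Fin n → FreeAlgebra ℂ (HOGen n G)) : Ring (HO ρ κ) :=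
  inferInstanceAs (Ring (RingQuot (HORel ρ κ)))

instance {n : ℕ} {G : Type} [Group G] (ρ : G →* Equiv.Perm (Fin n))
    (κ : Fin n → Fin n → FreeAlgebra ℂ (HOGen n G)) : Algebra ℂ (HO ρ κ) :=
  inferInstanceAs (Algebra ℂ (RingQuot (HORel ρ κ)))

/-- The quotient map from the free algebra. -/
def hMk {n : ℕ} {G : Type} [Group G] (ρ : G →* Equiv.Perm (Fin n))
    (κ : Fin n → Fin n → FreeAlgebra ℂ (HOGen n G)) :
    FreeAlgebra ℂ (HOGen n G) →ₐ[ℂ] HO ρ κ :=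
  RingQuot.mkAlgHom ℂ (HORel ρ κ)

/-- `[η_i, ξ_j]_+` in type `A_{n-1}`. -/
def kappaA {n : ℕ} (t u : ℂ) (i j : Fin n) : FreeAlgebra ℂ (HOGen n (Equiv.Perm (Fin n))) :=
  if i = j then
    t • 1 + u • ∑ k ∈ Finset.univ.erase i, fGrp n (Equiv.swap k i)
  else u • fGrp n (Equiv.swap i j)

/-- `[η_i, ξ_j]_+` in type `D_n`. -/
def kappaD {n : ℕ} (t u : ℂ) (i j : Fin n) : FreeAlgebra ℂ (HOGen n (WD n)) :=
  if i = j then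
    t • 1 + u • ∑ k ∈ Finset.univ.erase i, (fGrp n (sD k i) + fGrp n (sbarD k i))
  else u • (fGrp n (sD i j) + fGrp n (sbarD i j))

/-- `[η_i, ξ_j]_+` in type `B_n`. -/
def kappaB {n : ℕ} (t u v : ℂ) (i j : Fin n) : FreeAlgebra ℂ (HOGen n (WB n)) :=
  if i = j then
    t • 1 + u • ∑ k ∈ Finset.univ.erase i, (fGrp n (sB k i) + fGrp n (sbarB k i))
      + v • fGrp n (tauB i)
  else u • (fGrp n (sB i j) + fGrp n (sbarB i j))

section HO

variable {n : ℕ} {G : Type} [Group G] (ρ : G →* Equiv.Perm (Fin n))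
  (κ : Fin n → Fin n → FreeAlgebra ℂ (HOGen n G))

/-- `ξ_i` in the odd double affine Hecke algebra. -/
def hXi (i : Fin n) : HO ρ κ := hMk ρ κ (fXi G i)

/-- `η_i` in the odd double affine Hecke algebra. -/
def hEta (i : Fin n) : HO ρ κ := hMk ρ κ (fEta G i)

/-- The group element `g` in the odd double affine Hecke algebra. -/
def hGrp (g : G) : HO ρ κ := hMk ρ κ (fGrp n g)

/-- The canonical homomorphism from the skew-polynomial algebra, `ξ_i ↦ ξ_i`. -/
def skewToHO : Skew n →ₐ[ℂ] HO ρ κ :=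
  skewLift (hXi ρ κ) (by
    intro i j h
    have h1 : hMk ρ κ _ = hMk ρ κ _ :=
      RingQuot.mkAlgHom_rel ℂ (HORel.xi_xi (ρ := ρ) (κ := κ) i j h)
    simpa only [hXi, map_mul, map_neg] using h1)

/-- The subalgebra `𝔥_η` generated by the `η_i` and `ℂ G`. -/
def hSub : Subalgebra ℂ (HO ρ κ) :=
  Algebra.adjoin ℂ (Set.range (hEta ρ κ) ∪ Set.range (hGrp ρ κ))

/-- `η_i` as an element of `𝔥_η`. -/
def subEta (i : Fin n) : hSub ρ κ :=
  ⟨hEta ρ κ i, Algebra.subset_adjoin (Or.inl ⟨i, rfl⟩)⟩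

/-- The group element `g` as an element of `𝔥_η`. -/
def subGrp (g : G) : hSub ρ κ :=
  ⟨hGrp ρ κ g, Algebra.subset_adjoin (Or.inr ⟨g, rfl⟩)⟩

/-- `ε` is the character of `𝔥_η` extending the trivial character of `G` by letting each `η_i`
act as zero. -/
def IsTrivialChar (ε : hSub ρ κ →ₐ[ℂ] ℂ) : Prop :=
  (∀ g, ε (subGrp ρ κ g) = 1) ∧ ∀ i, ε (subEta ρ κ i) = 0

end HO

/-! ### Induced modules -/

/-- The one-dimensional module on which `b` acts as the scalar `ε b`. -/
def CharModule {B : Type} [Semiring B] [Algebra ℂ B] (_ε : B →ₐ[ℂ] ℂ) : Type := ℂ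

instance {B : Type} [Semiring B] [Algebra ℂ B] (ε : B →ₐ[ℂ] ℂ) : AddCommGroup (CharModule ε) :=
  inferInstanceAs (AddCommGroup ℂ)

instance {B : Type} [Semiring B] [Algebra ℂ B] (ε : B →ₐ[ℂ] ℂ) : Module ℂ (CharModule ε) :=
  inferInstanceAs (Module ℂ ℂ)

instance {B : Type} [Semiring B] [Algebra ℂ B] (ε : B →ₐ[ℂ] ℂ) : Module B (CharModule ε) :=
  Module.compHom ℂ ε.toRingHom

/-- The generator `1` of a one-dimensional module given by a character. -/
def charOne {B : Type} [Semiring B] [Algebra ℂ B] (ε : B →ₐ[ℂ] ℂ) : CharModule ε := (1 : ℂ)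

theorem charModule_smul {B : Type} [Semiring B] [Algebra ℂ B] (ε : B →ₐ[ℂ] ℂ) (b : B) :
    b • charOne ε = ε b • charOne ε := rfl

section Ind

variable {A : Type} [Ring A] [Algebra ℂ A] (B : Subalgebra ℂ A)
  (V : Type) [AddCommGroup V] [Module ℂ V] [Module B V]

/-- The `A`-submodule of `A ⊗_ℂ V` generated by the elements `a b ⊗ v - a ⊗ b v`, `b ∈ B`. -/
def indRel : Submodule A (A ⊗[ℂ] V) :=
  Submodule.span A {x | ∃ (a : A) (b : B) (v : V), x = (a * (b : A)) ⊗ₜ[ℂ] v - a ⊗ₜ[ℂ] (b • v)}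

/-- The induced module `Ind_B^A V = A ⊗_B V`. -/
abbrev Ind : Type := (A ⊗[ℂ] V) ⧸ indRel B V

/-- The class of `a ⊗ v` in the induced module. -/
def indMk (a : A) (v : V) : Ind B V := (indRel B V).mkQ (a ⊗ₜ[ℂ] v)

end Ind

/-! ### Dunkl operators and the induced representation -/

/-- The numerator
`(ξ_i - ξ_k) s_{ik} - (ξ_i τ_i - ξ_k τ_k)` of the Dunkl operators, applied to `f`. -/
def dunklNum {n : ℕ} (i k : Fin n) (f : Skew n) : Skew n :=
  (xi i - xi k) * act (sB i k) f - (xi i * act (tauB i) f - xi k * act (tauB k) f)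

/-- The operator `1/(ξ_i² - ξ_k²) · ((ξ_i - ξ_k) s_{ik} - (ξ_i τ_i - ξ_k τ_k))`. -/
def dunklFrac {n : ℕ} (i k : Fin n) (f : Skew n) : Skew n :=
  leftQuot (xi i ^ 2 - xi k ^ 2) (dunklNum i k f)

/-- The Dunkl operator of type `A_{n-1}`. -/
def dunklA {n : ℕ} (t u : ℂ) (i : Fin n) (f : Skew n) : Skew n :=
  t • oddPartial i f + u • ∑ k ∈ Finset.univ.erase i, dunklFrac i k f

/-- The Dunkl operator of type `D_n`. -/
def dunklD {n : ℕ} (t u : ℂ) (i : Fin n) (f : Skew n) : Skew n :=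
  t • oddPartial i f + u • ∑ k ∈ Finset.univ.erase i, (2 : ℂ) • dunklFrac i k f

/-- The Dunkl operator of type `B_n`. -/
def dunklB {n : ℕ} (t u v : ℂ) (i : Fin n) (f : Skew n) : Skew n :=
  t • oddPartial i f + v • leftQuot ((2 : ℂ) • xi i) (f - act (tauB i) f)
    + u • ∑ k ∈ Finset.univ.erase i, (2 : ℂ) • dunklFrac i k f

/-- The map `f ↦ f ⊗ 1` from the skew-polynomial algebra to the module induced from a character
of `𝔥_η`. -/
def toInd {n : ℕ} {G : Type} [Group G] (ρ : G →* Equiv.Perm (Fin n))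
    (κ : Fin n → Fin n → FreeAlgebra ℂ (HOGen n G)) (ε : hSub ρ κ →ₐ[ℂ] ℂ) (f : Skew n) :
    Ind (hSub ρ κ) (CharModule ε) :=
  indMk (hSub ρ κ) (CharModule ε) (skewToHO ρ κ f) (charOne ε)

/-- The trivial `ℂ G`-module extends uniquely to `𝔥_η` with every `η_i` acting as zero, and
on the induced module, identified with the skew-polynomial algebra by the linear bijection
`f ↦ f ⊗ 1`, the elements `g ∈ G` act by permuting indices through `ρ`, the `ξ_i` act by left
multiplication and the `η_i` act by the pairwise anti-commuting operators `T_i`. -/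
def InducedRealization {n : ℕ} {G : Type} [Group G] (ρ : G →* Equiv.Perm (Fin n))
    (κ : Fin n → Fin n → FreeAlgebra ℂ (HOGen n G)) (T : Fin n → Skew n → Skew n) : Prop :=
  (∃! ε : hSub ρ κ →ₐ[ℂ] ℂ, IsTrivialChar ρ κ ε) ∧
  (∀ ε : hSub ρ κ →ₐ[ℂ] ℂ, IsTrivialChar ρ κ ε →
    IsLinearMap ℂ (toInd ρ κ ε) ∧ Function.Bijective (toInd ρ κ ε) ∧
    (∀ (g : G) (f : Skew n),
      hGrp ρ κ g • toInd ρ κ ε f = toInd ρ κ ε (permAct (ρ g) f)) ∧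
    (∀ (i : Fin n) (f : Skew n), hXi ρ κ i • toInd ρ κ ε f = toInd ρ κ ε (xi i * f)) ∧
    (∀ (i : Fin n) (f : Skew n), hEta ρ κ i • toInd ρ κ ε f = toInd ρ κ ε (T i f))) ∧
  (∀ i j : Fin n, i ≠ j → ∀ f : Skew n, T i (T j f) = -T j (T i f))

end

end OddDaha

namespace OddDaha

open scoped TensorProduct

noncomputable section

/-! ### Induction on skew polynomials -/

/-! A linear operator `S` on skew polynomials is determined by `S 1` and by the anticommutators `S
ξ_j + ξ_j S`. Each Dunkl operator kills `1`, and its anticommutators with the `ξ_j` are the images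
of the defining relations (`IsSkewDer`). For the divided differences this is read off from the
numerators, whose denominators are central and cancellable (`dunklNum_xi_mul`,
`xi_sq_sub_mul_cancel`).

On polynomials `W` acts through unsigned permutations, so the barred and unbarred transpositions
agree and each `τ_i` acts as `1`. All three types therefore become one family `kappaEnd a u`: `(t,
u)` for A, `(t, 2u)` for D, `(t + v, 2u)` for B.

Equivariance and anticommutativity of the operators follow from the same principle: the relevant
difference or sum kills `1` and is carried past `ξ_j` with no correction term, hence vanishes
(`IsSkewDer.eq_zero_of_twisted`). This gives the polynomial representation `dunklRep`, in which the
constants form the trivial character of `𝔥_η`. On the induced module the generators act by the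
stated formulas, so the image of `f ↦ f ⊗ 1` is a submodule and exhausts it. Evaluating `dunklRep`
at `1` gives a left inverse. -/

theorem skewMk_surjective (n : ℕ) : Function.Surjective (skewMk n) :=
  RingQuot.mkAlgHom_surjective ℂ (SkewRel n)

/-- To prove a property of all skew polynomials it suffices to treat `1`, linear combinations and
left multiplication by the generators. -/
theorem skew_induction {n : ℕ} {p : Skew n → Prop} (one : p 1)
    (smul : ∀ (c : ℂ) f, p f → p (c • f)) (add : ∀ f g, p f → p g → p (f + g))
    (xi_mul : ∀ i f, p f → p (xi i * f)) (f : Skew n) : p f := by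
  obtain ⟨a, rfl⟩ := skewMk_surjective n f
  -- Quantifying over a right factor `g` lets products in the free algebra be peeled off one factor
  -- at a time.
  suffices h : ∀ g, p g → p (skewMk n a * g) by simpa using h 1 one
  induction a using FreeAlgebra.induction with
  | grade0 r =>
    intro g hg
    rw [AlgHom.commutes, ← Algebra.smul_def]
    exact smul r g hg
  | grade1 i => exact fun g hg => xi_mul i g hg
  | mul a b ha hb =>
    intro g hg
    rw [map_mul, mul_assoc]
    exact ha _ (hb _ hg)
  | add a b ha hb =>
    intro g hg
    rw [map_add, add_mul]
    exact add _ _ (ha _ hg) (hb _ hg)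

/-! ### A faithful representation on polynomials -/

/-- The algebra endomorphism of the polynomial ring changing the signs of the `X_j`, `j < i`. -/
def flipBelow {n : ℕ} (i : Fin n) : MvPolynomial (Fin n) ℂ →ₐ[ℂ] MvPolynomial (Fin n) ℂ :=
  MvPolynomial.aeval fun j => if j < i then -MvPolynomial.X j else MvPolynomial.X j

theorem flipBelow_X {n : ℕ} (i j : Fin n) :
    flipBelow i (MvPolynomial.X j) = if j < i then -MvPolynomial.X j else MvPolynomial.X j :=
  MvPolynomial.aeval_X _ _

theorem flipBelow_comm {n : ℕ} (i j : Fin n) (p : MvPolynomial (Fin n) ℂ) :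
    flipBelow i (flipBelow j p) = flipBelow j (flipBelow i p) := by
  have h : (flipBelow i).comp (flipBelow j) = (flipBelow j).comp (flipBelow i) := by
    refine MvPolynomial.algHom_ext fun k => ?_
    simp only [AlgHom.comp_apply, flipBelow_X]
    split_ifs <;> simp [flipBelow_X, *]
  exact DFunLike.congr_fun h p

theorem flipBelow_flipBelow {n : ℕ} (i : Fin n) (p : MvPolynomial (Fin n) ℂ) :
    flipBelow i (flipBelow i p) = p := by
  have h : (flipBelow i).comp (flipBelow i) = AlgHom.id ℂ _ := by
    refine MvPolynomial.algHom_ext fun k => ?_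
    simp only [AlgHom.comp_apply, flipBelow_X]
    split_ifs <;> simp [flipBelow_X, *]
  exact DFunLike.congr_fun h p

theorem flipBelow_monomial {n : ℕ} (i : Fin n) (a : Fin n →₀ ℕ) :
    flipBelow i (MvPolynomial.monomial a 1) =
      (∏ j, if j < i then (-1 : ℂ) ^ a j else 1) • MvPolynomial.monomial a 1 := by
  have h : (MvPolynomial.monomial a (1 : ℂ)) = ∏ j, MvPolynomial.X j ^ a j := by
    rw [MvPolynomial.monomial_eq, map_one, one_mul, Finsupp.prod_fintype _ _ (by simp)]
  rw [h, map_prod, MvPolynomial.smul_eq_C_mul, map_prod, ← Finset.prod_mul_distrib]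
  refine Finset.prod_congr rfl fun j _ => ?_
  rw [map_pow, flipBelow_X]
  split_ifs
  · rw [neg_pow]; simp
  · simp

/-- The operator `X_i` composed with the sign changes at all `j < i`. -/
def skewOp {n : ℕ} (i : Fin n) : Module.End ℂ (MvPolynomial (Fin n) ℂ) :=
  LinearMap.mulLeft ℂ (MvPolynomial.X i) ∘ₗ (flipBelow i).toLinearMap

theorem skewOp_apply {n : ℕ} (i : Fin n) (p : MvPolynomial (Fin n) ℂ) :
    skewOp i p = MvPolynomial.X i * flipBelow i p := rfl

/-- Of the two sign changes, only the one attached to the larger index affects the other variable,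
so exactly one order of composition picks up a sign. -/
theorem skewOp_anti {n : ℕ} (i j : Fin n) (h : i ≠ j) :
    skewOp i * skewOp j = -(skewOp j * skewOp i) := by
  refine LinearMap.ext fun p => ?_
  simp only [Module.End.mul_apply, LinearMap.neg_apply, skewOp_apply, map_mul, flipBelow_X,
    flipBelow_comm i j]
  rcases lt_or_gt_of_ne h with h | h
  · simp only [h, h.not_gt, if_true, if_false]; ring
  · simp only [h, h.not_gt, if_true, if_false]; ring

/-- The representation of the skew-polynomial algebra on polynomials. -/
def polyRep (n : ℕ) : Skew n →ₐ[ℂ] Module.End ℂ (MvPolynomial (Fin n) ℂ) :=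
  skewLift skewOp skewOp_anti

/-- The product of the `ξ_j ^ a_j` over a list of indices. -/
def listMonomial {n : ℕ} (l : List (Fin n)) (a : Fin n →₀ ℕ) : Skew n :=
  (l.map fun j => xi j ^ a j).prod

theorem xi_mul_pow {n : ℕ} {i j : Fin n} (h : i ≠ j) (m : ℕ) :
    (xi i : Skew n) * xi j ^ m = (-1 : ℂ) ^ m • (xi j ^ m * xi i) := by
  induction m with
  | zero => simp
  | succ m ih =>
    rw [pow_succ, ← mul_assoc, ih, smul_mul_assoc, mul_assoc, xi_anti h, pow_succ, mul_neg,
      smul_neg, mul_neg_one, neg_smul, mul_assoc]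

theorem listMonomial_add_single {n : ℕ} (l : List (Fin n)) (a : Fin n →₀ ℕ) {i : Fin n}
    (h : i ∉ l) : listMonomial l (a + Finsupp.single i 1) = listMonomial l a := by
  unfold listMonomial
  congr 1
  refine List.map_congr_left fun j hj => ?_
  have : i ≠ j := fun e => h (e ▸ hj)
  simp [Finsupp.single_eq_of_ne this.symm]

/-- Moving `ξ_i` to its place in an increasing product passes exactly the `ξ_j ^ a_j` with `j < i`,
each at the cost of `(-1) ^ a_j`. This is the sign by which `flipBelow i` acts on the monomial. -/
theorem xi_mul_listMonomial {n : ℕ} (l : List (Fin n)) (hl : l.Pairwise (· < ·))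
    (a : Fin n →₀ ℕ) {i : Fin n} (hi : i ∈ l) :
    xi i * listMonomial l a =
      (l.map fun j => if j < i then (-1 : ℂ) ^ a j else 1).prod •
        listMonomial l (a + Finsupp.single i 1) := by
  induction l with
  | nil => simp at hi
  | cons j l ih =>
    rw [List.pairwise_cons] at hl
    by_cases hij : i = j
    · subst hij
      have h1 : i ∉ l := fun h => lt_irrefl _ (hl.1 i h)
      have h2 : (l.map fun j => if j < i then (-1 : ℂ) ^ a j else 1).prod = 1 := by
        refine List.prod_eq_one fun x hx => ?_
        obtain ⟨k, hk, rfl⟩ := List.mem_map.1 hx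
        rw [if_neg (hl.1 k hk).not_gt]
      have h3 := listMonomial_add_single l a h1
      simp only [listMonomial, Finsupp.add_apply] at h3
      simp only [listMonomial, List.map_cons, List.prod_cons, h2, h3, lt_irrefl, if_false,
        one_smul, mul_one, Finsupp.add_apply, Finsupp.single_eq_same, ← mul_assoc, pow_succ']
    · have h1 : i ∈ l := (List.mem_cons.1 hi).resolve_left hij
      have h2 := ih hl.2 h1
      have h3 : j < i := hl.1 i h1
      simp only [listMonomial, Finsupp.add_apply] at h2
      simp only [listMonomial, List.map_cons, List.prod_cons, h3, if_true, Finsupp.add_apply,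
        Finsupp.single_eq_of_ne (Ne.symm hij), add_zero]
      rw [← mul_assoc, xi_mul_pow hij, smul_mul_assoc, mul_assoc, h2, mul_smul_comm, smul_smul]

/-- The linear map sending a monomial to the ordered monomial in the `ξ_j`. -/
def polyToSkew (n : ℕ) : MvPolynomial (Fin n) ℂ →ₗ[ℂ] Skew n :=
  (MvPolynomial.basisMonomials (Fin n) ℂ).constr ℂ (listMonomial (List.finRange n))

theorem polyToSkew_monomial {n : ℕ} (a : Fin n →₀ ℕ) :
    polyToSkew n (MvPolynomial.monomial a 1) = listMonomial (List.finRange n) a := by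
  have h := (MvPolynomial.basisMonomials (Fin n) ℂ).constr_basis ℂ
    (listMonomial (List.finRange n)) a
  rwa [MvPolynomial.coe_basisMonomials] at h

theorem polyToSkew_skewOp {n : ℕ} (i : Fin n) (p : MvPolynomial (Fin n) ℂ) :
    polyToSkew n (skewOp i p) = xi i * polyToSkew n p := by
  have h : polyToSkew n ∘ₗ skewOp i = LinearMap.mulLeft ℂ (xi i) ∘ₗ polyToSkew n := by
    refine (MvPolynomial.basisMonomials (Fin n) ℂ).ext fun a => ?_
    simp only [MvPolynomial.coe_basisMonomials, LinearMap.comp_apply, LinearMap.mulLeft_apply,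
      polyToSkew_monomial, skewOp_apply, flipBelow_monomial, mul_smul_comm, map_smul]
    rw [xi_mul_listMonomial _ (List.pairwise_lt_finRange n) a (List.mem_finRange i), mul_comm,
      MvPolynomial.X, MvPolynomial.monomial_mul, mul_one, polyToSkew_monomial,
      ← List.ofFn_eq_map, List.prod_ofFn]
  exact LinearMap.congr_fun h p

/-- Since `polyToSkew` intertwines `skewOp i` with left multiplication by `ξ_i`, applying `f` to the
constant polynomial `1` loses nothing: the representation is faithful, already on the vector `1`. -/
theorem polyToSkew_polyRep {n : ℕ} (f : Skew n) : polyToSkew n (polyRep n f 1) = f := by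
  induction f using skew_induction with
  | one =>
    rw [map_one (polyRep n), Module.End.one_apply, ← MvPolynomial.C_1,
      ← MvPolynomial.monomial_zero', polyToSkew_monomial]
    refine List.prod_eq_one fun x hx => ?_
    obtain ⟨k, hk, rfl⟩ := List.mem_map.1 hx
    simp
  | smul c f ih => simp [ih]
  | add f g hf hg => simp [hf, hg]
  | xi_mul i f ih =>
    rw [map_mul, Module.End.mul_apply, polyRep, skewLift_xi, polyToSkew_skewOp, ← polyRep, ih]

/-- The two sign changes cancel and do not touch `X_i`. Squares thus act by ordinary multiplication
in a domain, where cancellation is available. -/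
theorem polyRep_xi_sq {n : ℕ} (i : Fin n) (p : MvPolynomial (Fin n) ℂ) :
    polyRep n (xi i ^ 2) p = MvPolynomial.X i ^ 2 * p := by
  rw [sq, map_mul, polyRep, skewLift_xi, Module.End.mul_apply, skewOp_apply, skewOp_apply,
    map_mul, flipBelow_X, if_neg (lt_irrefl _), flipBelow_flipBelow, sq, mul_assoc]

/-! ### Cancellation -/

theorem xi_sq_sub_mul_cancel {n : ℕ} {i k : Fin n} (h : i ≠ k) {p q : Skew n}
    (hpq : (xi i ^ 2 - xi k ^ 2) * p = (xi i ^ 2 - xi k ^ 2) * q) : p = q := by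
  have h1 : (MvPolynomial.X i ^ 2 - MvPolynomial.X k ^ 2 : MvPolynomial (Fin n) ℂ) ≠ 0 := by
    intro h0
    -- At the point with `i`-th coordinate `1` and all others `0`, the difference of squares takes
    -- the value `1`.
    have h2 := congrArg (MvPolynomial.eval (Pi.single i (1 : ℂ))) h0
    simp [Pi.single_eq_of_ne h.symm] at h2
  have h2 := DFunLike.congr_fun (congrArg (polyRep n) hpq) 1
  simp only [map_mul, map_sub, Module.End.mul_apply, LinearMap.sub_apply, polyRep_xi_sq,
    ← sub_mul] at h2
  rw [← polyToSkew_polyRep p, ← polyToSkew_polyRep q, mul_left_cancel₀ h1 h2]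

theorem two_xi_mul_cancel {n : ℕ} {i : Fin n} {p q : Skew n}
    (hpq : ((2 : ℂ) • xi i) * p = ((2 : ℂ) • xi i) * q) : p = q := by
  have h1 : (MvPolynomial.X i ^ 2 : MvPolynomial (Fin n) ℂ) ≠ 0 :=
    pow_ne_zero _ (MvPolynomial.X_ne_zero i)
  rw [smul_mul_assoc, smul_mul_assoc] at hpq
  -- Another factor `ξ_i` on the left turns `ξ_i` into its square, to which `polyRep_xi_sq` applies.
  have h3 := congrArg (xi i * ·) (smul_right_injective _ (two_ne_zero (α := ℂ)) hpq)
  simp only [← mul_assoc, ← sq] at h3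
  have h2 := DFunLike.congr_fun (congrArg (polyRep n) h3) 1
  simp only [map_mul, Module.End.mul_apply, polyRep_xi_sq] at h2
  rw [← polyToSkew_polyRep p, ← polyToSkew_polyRep q, mul_left_cancel₀ h1 h2]

/-! ### Actions of signed permutations on generators -/

theorem act_xi {n : ℕ} (w : WB n) (j : Fin n) :
    act w (xi j) = (((w.left (w.right j) : ℤˣ) : ℤ) : ℂ) • xi (w.right j) :=
  skewLift_xi _ _ j

@[simp]
theorem permAct_xi {n : ℕ} (π : Equiv.Perm (Fin n)) (j : Fin n) :
    permAct π (xi j) = xi (π j) := by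
  rw [permAct, act_xi]; simp

theorem act_sB {n : ℕ} (i k : Fin n) : act (sB i k) = permAct (Equiv.swap i k) := rfl

theorem act_tauB_xi {n : ℕ} (i j : Fin n) :
    act (tauB i) (xi j) = if j = i then -xi j else xi j := by
  rw [act_xi]
  by_cases h : j = i
  · subst h; simp [tauB]
  · simp [tauB, h]

/-- The action of permutations as a homomorphism to linear operators. -/
def permHom (n : ℕ) : Equiv.Perm (Fin n) →* Module.End ℂ (Skew n) where
  toFun π := (permAct π).toLinearMap
  map_one' := by
    refine LinearMap.ext fun f => ?_
    induction f using skew_induction with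
    | one => simp
    | smul c f ih => rw [map_smul, map_smul, ih]
    | add f g hf hg => rw [map_add, map_add, hf, hg]
    | xi_mul i f ih => simp_all
  map_mul' π σ := by
    refine LinearMap.ext fun f => ?_
    induction f using skew_induction with
    | one => simp
    | smul c f ih => rw [map_smul, map_smul, ih]
    | add f g hf hg => rw [map_add, map_add, hf, hg]
    | xi_mul i f ih => simp_all

theorem permHom_apply {n : ℕ} (π : Equiv.Perm (Fin n)) (f : Skew n) :
    permHom n π f = permAct π f := rfl

theorem permHom_xi_mul {n : ℕ} (π : Equiv.Perm (Fin n)) (j : Fin n) (f : Skew n) :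
    permHom n π (xi j * f) = xi (π j) * permHom n π f := by
  simp [permHom_apply]

/-! ### Operators anticommuting with the generators up to a correction -/

/-- `S` is a linear operator killing `1` with `S ξ_j + ξ_j S = K j` for all `j`. -/
structure IsSkewDer {n : ℕ} (K : Fin n → Module.End ℂ (Skew n)) (S : Skew n → Skew n) :
    Prop where
  map_add : ∀ f g, S (f + g) = S f + S g
  map_smul : ∀ (c : ℂ) f, S (c • f) = c • S f
  map_one : S 1 = 0
  map_xi_mul : ∀ j f, S (xi j * f) = K j f - xi j * S f

namespace IsSkewDer

variable {n : ℕ} {K L : Fin n → Module.End ℂ (Skew n)} {S R : Skew n → Skew n}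

/-- The operator as a linear map. -/
def toLinearMap (h : IsSkewDer K S) : Module.End ℂ (Skew n) where
  toFun := S
  map_add' := h.map_add
  map_smul' := h.map_smul

theorem toLinearMap_apply (h : IsSkewDer K S) (f : Skew n) : h.toLinearMap f = S f := rfl

theorem zero : IsSkewDer (0 : Fin n → Module.End ℂ (Skew n)) (fun _ => 0) where
  map_add := by simp
  map_smul := by simp
  map_one := rfl
  map_xi_mul := by simp

theorem add (hS : IsSkewDer K S) (hR : IsSkewDer L R) :
    IsSkewDer (K + L) (fun f => S f + R f) where
  map_add f g := by rw [hS.map_add, hR.map_add]; abel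
  map_smul c f := by rw [hS.map_smul, hR.map_smul, smul_add]
  map_one := by rw [hS.map_one, hR.map_one, add_zero]
  map_xi_mul j f := by
    rw [hS.map_xi_mul, hR.map_xi_mul, mul_add, Pi.add_apply, LinearMap.add_apply]; abel

theorem smul (c : ℂ) (hS : IsSkewDer K S) : IsSkewDer (c • K) (fun f => c • S f) where
  map_add f g := by rw [hS.map_add, smul_add]
  map_smul d f := by rw [hS.map_smul, smul_comm]
  map_one := by rw [hS.map_one, smul_zero]
  map_xi_mul j f := by
    rw [hS.map_xi_mul, smul_sub, mul_smul_comm, Pi.smul_apply, LinearMap.smul_apply]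

theorem sum {ι : Type*} {K : ι → Fin n → Module.End ℂ (Skew n)} {S : ι → Skew n → Skew n}
    (s : Finset ι) (h : ∀ k ∈ s, IsSkewDer (K k) (S k)) :
    IsSkewDer (∑ k ∈ s, K k) (fun f => ∑ k ∈ s, S k f) := by
  classical
  induction s using Finset.induction_on with
  | empty => simpa using zero
  | insert a s ha ih =>
    simp only [Finset.sum_insert ha]
    exact (h a (Finset.mem_insert_self a s)).add
      (ih fun k hk => h k (Finset.mem_insert_of_mem hk))

/-- An operator `S` with `g S = N` for a left cancellable `g` inherits the defining
properties from `N`. -/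
theorem of_mul {g : Skew n} (hg : ∀ p q, g * p = g * q → p = q)
    {N : Skew n → Skew n} (hS : ∀ f, g * S f = N f)
    (map_add : ∀ f f', N (f + f') = N f + N f') (map_smul : ∀ (c : ℂ) f, N (c • f) = c • N f)
    (map_one : N 1 = 0) (map_xi_mul : ∀ j f, N (xi j * f) = g * (K j f - xi j * S f)) :
    IsSkewDer K S where
  map_add f f' := hg _ _ (by simp only [mul_add, hS, map_add])
  map_smul c f := hg _ _ (by simp only [mul_smul_comm, hS, map_smul])
  map_one := hg _ _ (by rw [hS, map_one, mul_zero])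
  map_xi_mul j f := hg _ _ (by rw [hS, map_xi_mul])

/-- A linear operator that anticommutes or commutes with the generators up to their
permutation and kills `1` vanishes. -/
theorem eq_zero_of_twisted {Z : Module.End ℂ (Skew n)} {y : Fin n → Skew n} (h1 : Z 1 = 0)
    (h : ∀ j f, Z (xi j * f) = y j * Z f) : Z = 0 := by
  refine LinearMap.ext fun f => ?_
  induction f using skew_induction with
  | one => simpa using h1
  | smul c f ih => simp_all
  | add f g hf hg => simp_all
  | xi_mul i f ih => simp_all

end IsSkewDer

/-! ### The odd derivation and the divided differences -/

/-- The Kronecker delta as an operator. -/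
def deltaEnd {n : ℕ} (i j : Fin n) : Module.End ℂ (Skew n) := if j = i then 1 else 0

theorem oddPartialHom_xi {n : ℕ} (i j : Fin n) :
    oddPartialHom i (xi j) = !![-xi j, if i = j then 1 else 0; 0, xi j] :=
  skewLift_xi _ _ j

theorem oddPartialHom_one_one {n : ℕ} (i : Fin n) (f : Skew n) : oddPartialHom i f 1 1 = f := by
  induction f using skew_induction with
  | one => simp
  | smul c f ih => simp [ih]
  | add f g hf hg => simp [hf, hg]
  | xi_mul j f ih => rw [map_mul, Matrix.mul_apply, Fin.sum_univ_two, ih, oddPartialHom_xi]; simp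

theorem isSkewDer_oddPartial {n : ℕ} (i : Fin n) : IsSkewDer (deltaEnd i) (oddPartial i) where
  map_add f g := by simp [oddPartial]
  map_smul c f := by simp [oddPartial]
  map_one := by simp [oddPartial]
  map_xi_mul j f := by
    rw [oddPartial, map_mul, Matrix.mul_apply, Fin.sum_univ_two, oddPartialHom_one_one,
      oddPartialHom_xi, ← oddPartial, deltaEnd]
    by_cases h : j = i
    · subst h; simp [sub_eq_neg_add]
    · simp [h, Ne.symm h]

/-- Passing a square costs two signs, so the denominators `ξ_i² - ξ_k²` are central. -/
theorem xi_sq_comm {n : ℕ} (i j : Fin n) : (xi i : Skew n) ^ 2 * xi j = xi j * xi i ^ 2 := by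
  by_cases h : i = j
  · rw [h, (Commute.pow_self (xi j) 2).eq]
  · rw [sq, mul_assoc, xi_anti h, mul_neg, ← mul_assoc, xi_anti h, neg_mul, neg_neg, mul_assoc]

theorem leftQuot_spec {n : ℕ} {g f : Skew n} (h : ∃ q, g * q = f) : g * leftQuot g f = f := by
  rw [leftQuot, dif_pos h]
  exact h.choose_spec

theorem dunklNum_add {n : ℕ} (i k : Fin n) (f g : Skew n) :
    dunklNum i k (f + g) = dunklNum i k f + dunklNum i k g := by
  simp only [dunklNum, map_add, mul_add]; abel

theorem dunklNum_smul {n : ℕ} (i k : Fin n) (c : ℂ) (f : Skew n) :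
    dunklNum i k (c • f) = c • dunklNum i k f := by
  simp only [dunklNum, map_smul, mul_smul_comm, smul_sub]

theorem dunklNum_one {n : ℕ} (i k : Fin n) : dunklNum i k (1 : Skew n) = 0 := by
  simp [dunklNum]

/-- The anticommutator of `ξ_j` with the divided difference attached to `i`, `k`. -/
def swapEnd {n : ℕ} (i k j : Fin n) : Module.End ℂ (Skew n) :=
  if j = i ∨ j = k then permHom n (Equiv.swap i k) else 0

/-- For `j = i` or `j = k` the `τ` terms cancel in the anticommutator with `ξ_j`, and the mixed
products in front of `s_{ik}` cancel as well, leaving `ξ_i² - ξ_k²`. For other `j` everything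
anticommutes. -/
theorem dunklNum_xi_mul {n : ℕ} {i k : Fin n} (h : i ≠ k) (j : Fin n) (f : Skew n) :
    dunklNum i k (xi j * f) =
      (xi i ^ 2 - xi k ^ 2) * swapEnd i k j f - xi j * dunklNum i k f := by
  have a1 := xi_anti h
  simp only [dunklNum, map_mul, act_tauB_xi, act_sB, permAct_xi, swapEnd]
  rcases eq_or_ne j i with rfl | hi
  · simp only [Equiv.swap_apply_left, true_or, if_true, if_neg h, permHom_apply, sq, sub_mul,
      mul_sub, ← mul_assoc, neg_mul, mul_neg, a1]
    abel
  rcases eq_or_ne j k with rfl | hk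
  · simp only [Equiv.swap_apply_right, or_true, if_true, if_neg hi, permHom_apply, sq, sub_mul,
      mul_sub, ← mul_assoc, neg_mul, mul_neg, a1]
    abel
  · have a2 := xi_anti hi
    have a3 := xi_anti hk
    simp only [Equiv.swap_apply_of_ne_of_ne hi hk, hi, hk, or_self, if_false,
      LinearMap.zero_apply, mul_zero, zero_sub, sub_mul, mul_sub, ← mul_assoc, neg_mul, a2, a3]
    abel

/-- Because the denominator is central, the recursion for the numerator passes to the quotient: if
`q` works for `f`, then `swapEnd i k j f - ξ_j q` works for `ξ_j f`. -/
theorem dvd_dunklNum {n : ℕ} {i k : Fin n} (h : i ≠ k) (f : Skew n) :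
    ∃ q, (xi i ^ 2 - xi k ^ 2) * q = dunklNum i k f := by
  induction f using skew_induction with
  | one => exact ⟨0, by rw [dunklNum_one, mul_zero]⟩
  | smul c f ih =>
    obtain ⟨q, hq⟩ := ih
    exact ⟨c • q, by rw [dunklNum_smul, mul_smul_comm, hq]⟩
  | add f g hf hg =>
    obtain ⟨p, hp⟩ := hf
    obtain ⟨q, hq⟩ := hg
    exact ⟨p + q, by rw [dunklNum_add, mul_add, hp, hq]⟩
  | xi_mul j f ih =>
    obtain ⟨q, hq⟩ := ih
    refine ⟨swapEnd i k j f - xi j * q, ?_⟩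
    rw [dunklNum_xi_mul h, ← hq, mul_sub, ← mul_assoc, ← mul_assoc, sub_mul _ _ (xi j),
      mul_sub (xi j), xi_sq_comm, xi_sq_comm]

theorem isSkewDer_dunklFrac {n : ℕ} {i k : Fin n} (h : i ≠ k) :
    IsSkewDer (swapEnd i k) (dunklFrac i k) := by
  have hS : ∀ f, (xi i ^ 2 - xi k ^ 2) * dunklFrac i k f = dunklNum i k f := fun f =>
    leftQuot_spec (dvd_dunklNum h f)
  refine .of_mul (fun p q => xi_sq_sub_mul_cancel h) hS (dunklNum_add i k) (dunklNum_smul i k)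
    (dunklNum_one i k) fun j f => ?_
  rw [dunklNum_xi_mul h, ← hS f, mul_sub, ← mul_assoc, ← mul_assoc, sub_mul _ _ (xi j),
    mul_sub (xi j), xi_sq_comm, xi_sq_comm]

/-- When `j = i` the left side is `ξ_i f + ξ_i f^{τ_i} = 2 ξ_i f - ξ_i (f - f^{τ_i})`. The quotient
thus obeys the same recursion as the odd derivation, which is why `v` merely adds to `t` in type B.
-/
theorem sub_act_tauB_xi_mul {n : ℕ} (i j : Fin n) {f q : Skew n}
    (hq : ((2 : ℂ) • xi i) * q = f - act (tauB i) f) :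
    xi j * f - act (tauB i) (xi j * f) =
      ((2 : ℂ) • xi i) * (deltaEnd i j f - xi j * q) := by
  rw [map_mul, act_tauB_xi, deltaEnd]
  rcases eq_or_ne j i with rfl | h
  · have h1 : (2 : ℂ) • xi j * (xi j * q) = xi j * (f - act (tauB j) f) := by
      rw [← hq, smul_mul_assoc, smul_mul_assoc, mul_smul_comm]
    rw [if_pos rfl, if_pos rfl, mul_sub, h1, Module.End.one_apply, two_smul, add_mul, mul_sub,
      neg_mul]
    abel
  · rw [if_neg h, if_neg h, ← mul_sub, ← hq, LinearMap.zero_apply, zero_sub, mul_neg,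
      smul_mul_assoc, smul_mul_assoc, mul_smul_comm, ← mul_assoc, ← mul_assoc, xi_anti h,
      neg_mul, smul_neg]

theorem dvd_sub_act_tauB {n : ℕ} (i : Fin n) (f : Skew n) :
    ∃ q, ((2 : ℂ) • xi i) * q = f - act (tauB i) f := by
  induction f using skew_induction with
  | one => exact ⟨0, by simp⟩
  | smul c f ih =>
    obtain ⟨q, hq⟩ := ih
    exact ⟨c • q, by rw [mul_smul_comm, hq, map_smul, smul_sub]⟩
  | add f g hf hg =>
    obtain ⟨p, hp⟩ := hf
    obtain ⟨q, hq⟩ := hg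
    exact ⟨p + q, by rw [mul_add, hp, hq, map_add]; abel⟩
  | xi_mul j f ih =>
    obtain ⟨q, hq⟩ := ih
    exact ⟨_, (sub_act_tauB_xi_mul i j hq).symm⟩

theorem isSkewDer_leftQuot_tauB {n : ℕ} (i : Fin n) :
    IsSkewDer (deltaEnd i) (fun f => leftQuot ((2 : ℂ) • xi i) (f - act (tauB i) f)) := by
  have hS : ∀ f, ((2 : ℂ) • xi i) * leftQuot ((2 : ℂ) • xi i) (f - act (tauB i) f) =
      f - act (tauB i) f := fun f => leftQuot_spec (dvd_sub_act_tauB i f)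
  refine .of_mul (fun p q => two_xi_mul_cancel) hS (fun f g => ?_) (fun c f => ?_) (by simp)
    fun j f => sub_act_tauB_xi_mul i j (hS f)
  · rw [map_add]; abel
  · rw [map_smul, smul_sub]

/-! ### Dunkl operators -/

/-- The anticommutator of `η_i` and `ξ_j` acting on skew polynomials. -/
def kappaEnd {n : ℕ} (a u : ℂ) (i j : Fin n) : Module.End ℂ (Skew n) :=
  if i = j then a • 1 + u • ∑ k ∈ Finset.univ.erase i, permHom n (Equiv.swap k i)
  else u • permHom n (Equiv.swap i j)

/-- `ξ_i` meets every divided difference in the sum, whereas `ξ_j` with `j ≠ i` meets only the one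
with `k = j`. -/
theorem sum_swapEnd {n : ℕ} (i j : Fin n) :
    (∑ k ∈ Finset.univ.erase i, swapEnd i k) j =
      if i = j then ∑ k ∈ Finset.univ.erase i, permHom n (Equiv.swap k i)
      else permHom n (Equiv.swap i j) := by
  rw [Finset.sum_apply]
  split_ifs with h
  · subst h
    refine Finset.sum_congr rfl fun k _ => ?_
    rw [swapEnd, if_pos (Or.inl rfl), Equiv.swap_comm]
  · rw [Finset.sum_eq_single j]
    · simp [swapEnd]
    · intro k _ hk
      simp [swapEnd, Ne.symm h, Ne.symm hk]
    · simp [Ne.symm h]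

theorem isSkewDer_dunkl {n : ℕ} (a u : ℂ) (i : Fin n) {D : Skew n → Skew n}
    (hD : IsSkewDer (a • deltaEnd i) D) :
    IsSkewDer (kappaEnd a u i)
      (fun f => D f + u • ∑ k ∈ Finset.univ.erase i, dunklFrac i k f) := by
  have h := hD.add (.smul u (.sum (Finset.univ.erase i) fun k hk =>
    isSkewDer_dunklFrac (Finset.ne_of_mem_erase hk).symm))
  convert h using 1
  funext j
  rw [Pi.add_apply, Pi.smul_apply, Pi.smul_apply, sum_swapEnd, kappaEnd, deltaEnd]
  by_cases hij : i = j
  · subst hij; simp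
  · simp [hij, Ne.symm hij]

theorem isSkewDer_dunklA {n : ℕ} (t u : ℂ) (i : Fin n) :
    IsSkewDer (kappaEnd t u i) (dunklA t u i) :=
  isSkewDer_dunkl t u i (.smul t (isSkewDer_oddPartial i))

theorem isSkewDer_dunklD {n : ℕ} (t u : ℂ) (i : Fin n) :
    IsSkewDer (kappaEnd t (2 * u) i) (dunklD t u i) := by
  have h := isSkewDer_dunkl t (2 * u) i (.smul t (isSkewDer_oddPartial i))
  convert h using 2 with f
  rw [dunklD, ← Finset.smul_sum, smul_smul, mul_comm]

theorem isSkewDer_dunklB {n : ℕ} (t u v : ℂ) (i : Fin n) :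
    IsSkewDer (kappaEnd (t + v) (2 * u) i) (dunklB t u v i) := by
  have h0 := (IsSkewDer.smul t (isSkewDer_oddPartial i)).add (.smul v (isSkewDer_leftQuot_tauB i))
  rw [← add_smul] at h0
  have h := isSkewDer_dunkl (t + v) (2 * u) i h0
  convert h using 2 with f
  rw [dunklB, ← Finset.smul_sum, smul_smul, mul_comm]

/-! ### Equivariance and anticommutativity of the Dunkl operators. -/

theorem permHom_mul_swap {n : ℕ} (π : Equiv.Perm (Fin n)) (i j : Fin n) :
    permHom n π * permHom n (Equiv.swap i j) =
      permHom n (Equiv.swap (π i) (π j)) * permHom n π := by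
  rw [← map_mul, ← map_mul, Equiv.mul_swap_eq_swap_mul]

theorem permHom_mul_kappaEnd {n : ℕ} (a u : ℂ) (π : Equiv.Perm (Fin n)) (i j : Fin n) :
    permHom n π * kappaEnd a u i j = kappaEnd a u (π i) (π j) * permHom n π := by
  simp only [kappaEnd, π.injective.eq_iff]
  split_ifs with h
  · simp only [mul_add, add_mul, mul_smul_comm, smul_mul_assoc, mul_one, one_mul,
      Finset.mul_sum, Finset.sum_mul, permHom_mul_swap]
    congr 2
    refine Finset.sum_equiv π (by simp) fun k _ => rfl
  · rw [mul_smul_comm, permHom_mul_swap, smul_mul_assoc]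

/-- The two sides have the same correction term at `ξ_j` by `permHom_mul_kappaEnd`, so their
difference kills `1` and turns `ξ_j` into `-ξ_{π j}`. -/
theorem dunkl_equivariant {n : ℕ} {a u : ℂ} {T : Fin n → Skew n → Skew n}
    (hT : ∀ i, IsSkewDer (kappaEnd a u i) (T i))
    (π : Equiv.Perm (Fin n)) (i : Fin n) (f : Skew n) :
    permHom n π (T i f) = T (π i) (permHom n π f) := by
  have h : permHom n π * (hT i).toLinearMap - (hT (π i)).toLinearMap * permHom n π = 0 := by
    refine IsSkewDer.eq_zero_of_twisted (y := fun j => -xi (π j)) ?_ fun j f => ?_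
    · simp [IsSkewDer.toLinearMap_apply, (hT _).map_one, permHom_apply]
    · have h1 := LinearMap.congr_fun (permHom_mul_kappaEnd a u π i j) f
      simp only [LinearMap.sub_apply, Module.End.mul_apply, IsSkewDer.toLinearMap_apply,
        (hT _).map_xi_mul, permHom_xi_mul, map_sub] at h1 ⊢
      rw [h1, neg_mul, mul_sub]
      abel
  exact sub_eq_zero.1 (LinearMap.congr_fun h f)

theorem dunkl_kappaEnd_self {n : ℕ} {a u : ℂ} {T : Fin n → Skew n → Skew n}
    (hT : ∀ i, IsSkewDer (kappaEnd a u i) (T i))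
    {i j : Fin n} (h : i ≠ j) (f : Skew n) :
    T i (kappaEnd a u j i f) + T j (kappaEnd a u i i f) =
      kappaEnd a u j i (T i f) + kappaEnd a u i i (T j f) := by
  have hP : ∀ (π : Equiv.Perm (Fin n)) i, (hT (π i)).toLinearMap * permHom n π =
      permHom n π * (hT i).toLinearMap := fun π i =>
    LinearMap.ext fun f => (dunkl_equivariant hT π i f).symm
  have h1 := hP (Equiv.swap j i) i
  have h2 := hP (Equiv.swap j i) j
  rw [Equiv.swap_apply_right] at h1
  rw [Equiv.swap_apply_left] at h2
  have h3 : (hT j).toLinearMap *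
        ∑ k ∈ (Finset.univ.erase i).erase j, permHom n (Equiv.swap k i) =
      (∑ k ∈ (Finset.univ.erase i).erase j, permHom n (Equiv.swap k i)) *
        (hT j).toLinearMap := by
    rw [Finset.mul_sum, Finset.sum_mul]
    refine Finset.sum_congr rfl fun k hk => ?_
    have h4 := hP (Equiv.swap k i) j
    rwa [Equiv.swap_apply_of_ne_of_ne (Finset.ne_of_mem_erase hk).symm h.symm] at h4
  have h5 : (hT i).toLinearMap * kappaEnd a u j i + (hT j).toLinearMap * kappaEnd a u i i =
      kappaEnd a u j i * (hT i).toLinearMap + kappaEnd a u i i * (hT j).toLinearMap := by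
    simp only [kappaEnd, if_neg h.symm, if_true]
    -- The summand `k = j` interchanges `T i` and `T j`, and combines with the other term. The
    -- remaining transpositions fix `j` and commute with `T j`.
    rw [← Finset.add_sum_erase _ _ (Finset.mem_erase.2 ⟨h.symm, Finset.mem_univ j⟩)]
    simp only [mul_add, add_mul, mul_smul_comm, smul_mul_assoc, smul_add, mul_one, one_mul, h1,
      h2, h3]
    abel
  exact LinearMap.congr_fun h5 f

/-- This is the vanishing of the correction when `T_i T_j + T_j T_i` is moved past `ξ_k`. For `k`
outside `{i, j}`, `s_{jk}` fixes `i` and `s_{ik}` fixes `j`, so each term commutes separately. -/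
theorem dunkl_kappaEnd_comm {n : ℕ} {a u : ℂ} {T : Fin n → Skew n → Skew n}
    (hT : ∀ i, IsSkewDer (kappaEnd a u i) (T i))
    {i j : Fin n} (h : i ≠ j) (k : Fin n) (f : Skew n) :
    T i (kappaEnd a u j k f) + T j (kappaEnd a u i k f) =
      kappaEnd a u j k (T i f) + kappaEnd a u i k (T j f) := by
  rcases eq_or_ne k i with rfl | hi
  · exact dunkl_kappaEnd_self hT h f
  rcases eq_or_ne k j with rfl | hj
  · rw [add_comm, dunkl_kappaEnd_self hT h.symm, add_comm]
  · simp only [kappaEnd, if_neg hi.symm, if_neg hj.symm, LinearMap.smul_apply, (hT _).map_smul,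
      dunkl_equivariant hT, Equiv.swap_apply_of_ne_of_ne h hi.symm,
      Equiv.swap_apply_of_ne_of_ne h.symm hj.symm]

/-- Applying the anticommutator rule twice, the two signs cancel: `T_i T_j + T_j T_i` commutes with
every `ξ_k` by `dunkl_kappaEnd_comm`, and it kills `1`. -/
theorem dunkl_anticomm {n : ℕ} {a u : ℂ} {T : Fin n → Skew n → Skew n}
    (hT : ∀ i, IsSkewDer (kappaEnd a u i) (T i))
    {i j : Fin n} (h : i ≠ j) (f : Skew n) :
    T i (T j f) = -T j (T i f) := by
  have h : (hT i).toLinearMap * (hT j).toLinearMap + (hT j).toLinearMap * (hT i).toLinearMap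
      = 0 := by
    refine IsSkewDer.eq_zero_of_twisted (y := xi) ?_ fun k f => ?_
    · have h0 := fun i => (hT i).toLinearMap.map_zero
      simp only [IsSkewDer.toLinearMap_apply] at h0
      simp [IsSkewDer.toLinearMap_apply, (hT _).map_one, h0]
    · have h0 := fun i => (hT i).toLinearMap.map_sub
      have h1 := dunkl_kappaEnd_comm hT h k f
      simp only [IsSkewDer.toLinearMap_apply] at h0
      simp only [LinearMap.add_apply, Module.End.mul_apply, IsSkewDer.toLinearMap_apply,
        (hT _).map_xi_mul, h0]
      rw [mul_add, ← sub_eq_zero]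
      rw [← sub_eq_zero] at h1
      rw [← h1]
      abel
  exact eq_neg_of_add_eq_zero_left (LinearMap.congr_fun h f)

/-! ### The polynomial representation of the odd double affine Hecke algebra -/

section Realization

variable {n : ℕ} {G : Type} [Group G] (ρ : G →* Equiv.Perm (Fin n))
  (κ : Fin n → Fin n → FreeAlgebra ℂ (HOGen n G))

theorem hMk_surjective : Function.Surjective (hMk ρ κ) :=
  RingQuot.mkAlgHom_surjective ℂ (HORel ρ κ)

variable {ρ κ} in
theorem hMk_rel {a b : FreeAlgebra ℂ (HOGen n G)} (h : HORel ρ κ a b) :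
    hMk ρ κ a = hMk ρ κ b :=
  RingQuot.mkAlgHom_rel ℂ h

theorem hGrp_mul_hXi (g : G) (j : Fin n) :
    hGrp ρ κ g * hXi ρ κ j = hXi ρ κ (ρ g j) * hGrp ρ κ g := by
  have h := hMk_rel (HORel.grp_xi (κ := κ) (ρ := ρ) g j)
  rwa [map_mul, map_mul] at h

theorem hEta_mul_hXi (i j : Fin n) :
    hEta ρ κ i * hXi ρ κ j = hMk ρ κ (κ i j) - hXi ρ κ j * hEta ρ κ i := by
  have h := hMk_rel (HORel.eta_xi (κ := κ) (ρ := ρ) i j)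
  rw [map_add, map_mul, map_mul] at h
  exact eq_sub_of_add_eq h

@[simp]
theorem skewToHO_xi (i : Fin n) : skewToHO ρ κ (xi i) = hXi ρ κ i := skewLift_xi _ _ i

/-- The operators on skew polynomials attached to the free generators. -/
def freeRep (T : Fin n → Module.End ℂ (Skew n)) :
    FreeAlgebra ℂ (HOGen n G) →ₐ[ℂ] Module.End ℂ (Skew n) :=
  FreeAlgebra.lift ℂ fun
    | .xi i => LinearMap.mulLeft ℂ (xi i)
    | .eta i => T i
    | .grp g => permHom n (ρ g)

section FreeRep

variable (T : Fin n → Module.End ℂ (Skew n))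

@[simp]
theorem freeRep_fXi (i : Fin n) : freeRep ρ T (fXi G i) = LinearMap.mulLeft ℂ (xi i) :=
  FreeAlgebra.lift_ι_apply _ _

@[simp]
theorem freeRep_fEta (i : Fin n) : freeRep ρ T (fEta G i) = T i :=
  FreeAlgebra.lift_ι_apply _ _

@[simp]
theorem freeRep_fGrp (g : G) : freeRep ρ T (fGrp n g) = permHom n (ρ g) :=
  FreeAlgebra.lift_ι_apply _ _

end FreeRep

/-- The polynomial representation given by Dunkl operators. -/
def dunklRep {a u : ℂ} {T : Fin n → Skew n → Skew n}
    (hT : ∀ i, IsSkewDer (kappaEnd a u i) (T i))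
    (hκ : ∀ i j, freeRep ρ (fun i => (hT i).toLinearMap) (κ i j) = kappaEnd a u i j) :
    HO ρ κ →ₐ[ℂ] Module.End ℂ (Skew n) :=
  RingQuot.liftAlgHom ℂ ⟨freeRep ρ fun i => (hT i).toLinearMap, by
    intro x y h
    refine LinearMap.ext fun f => ?_
    induction h with
    | grp_one => simp
    | grp_mul g h => simp
    | eta_eta i j h =>
      simp only [map_mul, map_neg, freeRep_fEta]
      exact dunkl_anticomm hT h f
    | xi_xi i j h => simp [← mul_assoc, xi_anti h]
    | grp_xi g j => simp [permHom_xi_mul]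
    | grp_eta g j =>
      simp only [map_mul, freeRep_fEta, freeRep_fGrp]
      exact dunkl_equivariant hT (ρ g) j f
    | eta_xi i j =>
      simp only [map_add, map_mul, freeRep_fEta, freeRep_fXi, hκ, LinearMap.add_apply,
        Module.End.mul_apply, LinearMap.mulLeft_apply, IsSkewDer.toLinearMap_apply,
        (hT i).map_xi_mul]
      abel⟩

section DunklRep

variable {a u : ℂ} {T : Fin n → Skew n → Skew n}
  (hT : ∀ i, IsSkewDer (kappaEnd a u i) (T i))
  (hκ : ∀ i j, freeRep ρ (fun i => (hT i).toLinearMap) (κ i j) = kappaEnd a u i j)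

theorem dunklRep_hMk (x : FreeAlgebra ℂ (HOGen n G)) :
    dunklRep ρ κ hT hκ (hMk ρ κ x) = freeRep ρ (fun i => (hT i).toLinearMap) x :=
  RingQuot.liftAlgHom_mkAlgHom_apply ℂ _ _ _

theorem dunklRep_skewToHO (f : Skew n) : dunklRep ρ κ hT hκ (skewToHO ρ κ f) 1 = f := by
  induction f using skew_induction with
  | one => simp
  | smul c f ih => simp [ih]
  | add f g hf hg => simp [hf, hg]
  | xi_mul i f ih =>
    rw [map_mul, map_mul, Module.End.mul_apply, ih, skewToHO_xi, hXi, dunklRep_hMk, freeRep_fXi,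
      LinearMap.mulLeft_apply]

/-- The augmentation of the skew-polynomial algebra. -/
def skewAug (n : ℕ) : Skew n →ₐ[ℂ] ℂ := skewLift 0 (by simp)

/-- The line of constants is stable under `𝔥_η`, since each `η_i` kills it and the group fixes it.
The augmentation reads off the scalar. -/
theorem dunklRep_hSub_one {x : HO ρ κ} (hx : x ∈ hSub ρ κ) :
    dunklRep ρ κ hT hκ x 1 = skewAug n (dunklRep ρ κ hT hκ x 1) • (1 : Skew n) := by
  induction hx using Algebra.adjoin_induction with
  | mem x hx =>
    rcases hx with ⟨i, rfl⟩ | ⟨g, rfl⟩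
    · simp [hEta, dunklRep_hMk, IsSkewDer.toLinearMap_apply, (hT i).map_one]
    · simp [hGrp, dunklRep_hMk, permHom_apply]
  | algebraMap r => simp [Algebra.algebraMap_eq_smul_one]
  | add x y _ _ hx hy =>
    rw [map_add, LinearMap.add_apply, map_add, add_smul, ← hx, ← hy]
  | mul x y _ _ hx hy =>
    rw [map_mul, Module.End.mul_apply, hy, map_smul, hx]
    simp [smul_smul]

/-- The character of `𝔥_η` on the line of constants. -/
def dunklChar : hSub ρ κ →ₐ[ℂ] ℂ :=
  AlgHom.ofLinearMap
    ((skewAug n).toLinearMap ∘ₗ LinearMap.applyₗ (1 : Skew n) ∘ₗ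
      (dunklRep ρ κ hT hκ).toLinearMap ∘ₗ (hSub ρ κ).val.toLinearMap)
    (by simp)
    (by
      intro x y
      have hx := dunklRep_hSub_one ρ κ hT hκ x.2
      have hy := dunklRep_hSub_one ρ κ hT hκ y.2
      simp only [LinearMap.comp_apply, AlgHom.toLinearMap_apply, LinearMap.applyₗ_apply_apply,
        map_mul, Subalgebra.coe_val, Module.End.mul_apply]
      rw [hy, map_smul, hx]
      simp [mul_comm])

theorem dunklChar_apply (x : hSub ρ κ) :
    dunklChar ρ κ hT hκ x = skewAug n (dunklRep ρ κ hT hκ x 1) := rfl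

theorem isTrivialChar_dunklChar : IsTrivialChar ρ κ (dunklChar ρ κ hT hκ) := by
  constructor
  · intro g
    have h : dunklRep ρ κ hT hκ (hGrp ρ κ g) = permHom n (ρ g) := by
      rw [hGrp, dunklRep_hMk, freeRep_fGrp]
    rw [dunklChar_apply, subGrp, h, permHom_apply, map_one, map_one]
  · intro i
    have h : dunklRep ρ κ hT hκ (hEta ρ κ i) = (hT i).toLinearMap := by
      rw [hEta, dunklRep_hMk, freeRep_fEta]
    rw [dunklChar_apply, subEta, h, IsSkewDer.toLinearMap_apply, (hT i).map_one, map_zero]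

variable {ρ κ} in
theorem IsTrivialChar.unique {ε ε' : hSub ρ κ →ₐ[ℂ] ℂ} (h : IsTrivialChar ρ κ ε)
    (h' : IsTrivialChar ρ κ ε') : ε = ε' := by
  refine AlgHom.adjoin_ext ?_
  rintro _ (⟨i, rfl⟩ | ⟨g, rfl⟩)
  · exact (h.2 i).trans (h'.2 i).symm
  · exact (h.1 g).trans (h'.1 g).symm

/-! ### The action on the induced module and the bijectivity of `f ↦ f ⊗ 1`. -/

theorem isLinearMap_toInd (ε : hSub ρ κ →ₐ[ℂ] ℂ) : IsLinearMap ℂ (toInd ρ κ ε) where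
  map_add f g := by simp only [toInd, indMk, map_add, TensorProduct.add_tmul]
  map_smul c f := by
    simp only [toInd, indMk, map_smul, ← TensorProduct.smul_tmul']
    rfl

theorem indMk_mul {A : Type} [Ring A] [Algebra ℂ A] (B : Subalgebra ℂ A)
    (V : Type) [AddCommGroup V] [Module ℂ V] [Module B V] (x y : A) (v : V) :
    indMk B V (x * y) v = x • indMk B V y v := rfl

theorem indMk_smul {A : Type} [Ring A] [Algebra ℂ A] (B : Subalgebra ℂ A)
    (V : Type) [AddCommGroup V] [Module ℂ V] [Module B V] (x : A) (b : B) (v : V) :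
    indMk B V (x * b) v = indMk B V x (b • v) := by
  exact (Submodule.Quotient.eq _).2 (Submodule.subset_span ⟨x, b, v, rfl⟩)

theorem hXi_smul_toInd (ε : hSub ρ κ →ₐ[ℂ] ℂ) (i : Fin n) (f : Skew n) :
    hXi ρ κ i • toInd ρ κ ε f = toInd ρ κ ε (xi i * f) := by
  rw [toInd, toInd, ← indMk_mul, map_mul, skewToHO_xi]

theorem hSub_smul_toInd_one (ε : hSub ρ κ →ₐ[ℂ] ℂ) (b : hSub ρ κ) :
    (b : HO ρ κ) • toInd ρ κ ε 1 = toInd ρ κ ε (ε b • 1) := by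
  rw [toInd, map_one, ← indMk_mul, mul_one, ← one_mul (b : HO ρ κ), indMk_smul,
    charModule_smul, (isLinearMap_toInd ρ κ ε).map_smul, toInd, map_one, indMk, indMk,
    TensorProduct.tmul_smul]
  rfl

theorem hGrp_smul_toInd {ε : hSub ρ κ →ₐ[ℂ] ℂ} (hε : IsTrivialChar ρ κ ε) (g : G) (f : Skew n) :
    hGrp ρ κ g • toInd ρ κ ε f = toInd ρ κ ε (permHom n (ρ g) f) := by
  have hl := isLinearMap_toInd ρ κ ε
  induction f using skew_induction with
  | one =>
    have h := hSub_smul_toInd_one ρ κ ε (subGrp ρ κ g)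
    rw [hε.1, one_smul] at h
    rw [permHom_apply, map_one]
    exact h
  | smul c f ih => rw [hl.map_smul, smul_comm, ih, map_smul, hl.map_smul]
  | add f f' hf hf' => rw [hl.map_add, smul_add, hf, hf', map_add, hl.map_add]
  | xi_mul i f ih =>
    rw [← hXi_smul_toInd, ← mul_smul, hGrp_mul_hXi, mul_smul, ih, hXi_smul_toInd,
      permHom_xi_mul]

/-- The right-hand sides `κ i j` lie in this span, so their action is known before that of the
`η_i`, as the induction in `hEta_smul_toInd` requires. -/
theorem adjoin_fGrp_smul_toInd {ε : hSub ρ κ →ₐ[ℂ] ℂ} (hε : IsTrivialChar ρ κ ε)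
    (T : Fin n → Module.End ℂ (Skew n)) {x : FreeAlgebra ℂ (HOGen n G)}
    (hx : x ∈ Submodule.span ℂ (insert 1 (Set.range (fGrp n (G := G))))) (f : Skew n) :
    hMk ρ κ x • toInd ρ κ ε f = toInd ρ κ ε (freeRep ρ T x f) := by
  have hl := isLinearMap_toInd ρ κ ε
  induction hx using Submodule.span_induction with
  | mem x hx =>
    rcases hx with rfl | ⟨g, rfl⟩
    · simp
    · rw [freeRep_fGrp]
      exact hGrp_smul_toInd ρ κ hε g f
  | zero => rw [map_zero, map_zero, zero_smul, LinearMap.zero_apply, hl.map_zero]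
  | add x y _ _ hx hy =>
    rw [map_add, map_add, add_smul, hx, hy, LinearMap.add_apply, hl.map_add]
  | smul c x _ hx =>
    rw [map_smul, map_smul, smul_assoc, hx, LinearMap.smul_apply, hl.map_smul]

variable (hs : ∀ i j, κ i j ∈ Submodule.span ℂ (insert 1 (Set.range (fGrp n (G := G)))))

include hκ hs in
theorem hEta_smul_toInd {ε : hSub ρ κ →ₐ[ℂ] ℂ} (hε : IsTrivialChar ρ κ ε)
    (i : Fin n) (f : Skew n) :
    hEta ρ κ i • toInd ρ κ ε f = toInd ρ κ ε (T i f) := by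
  have hl := isLinearMap_toInd ρ κ ε
  induction f using skew_induction with
  | one =>
    have h := hSub_smul_toInd_one ρ κ ε (subEta ρ κ i)
    rw [hε.2, zero_smul] at h
    rwa [(hT i).map_one]
  | smul c f ih => rw [hl.map_smul, smul_comm, ih, (hT i).map_smul, hl.map_smul]
  | add f f' hf hf' => rw [hl.map_add, smul_add, hf, hf', (hT i).map_add, hl.map_add]
  | xi_mul j f ih =>
    rw [← hXi_smul_toInd, ← mul_smul, hEta_mul_hXi, sub_smul, mul_smul, ih, hXi_smul_toInd,
      adjoin_fGrp_smul_toInd ρ κ hε (fun i => (hT i).toLinearMap) (hs i j), hκ,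
      (hT i).map_xi_mul, hl.map_sub]

include hκ hs in
-- The image is stable under all generators and contains `1 ⊗ 1`, which generates the induced
-- module.
theorem toInd_surjective {ε : hSub ρ κ →ₐ[ℂ] ℂ} (hε : IsTrivialChar ρ κ ε) :
    Function.Surjective (toInd ρ κ ε) := by
  have hl := isLinearMap_toInd ρ κ ε
  have h1 : ∀ (x : FreeAlgebra ℂ (HOGen n G)) (f : Skew n),
      ∃ f', toInd ρ κ ε f' = hMk ρ κ x • toInd ρ κ ε f := by
    intro x
    induction x using FreeAlgebra.induction with
    | grade0 r =>
      intro f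
      exact ⟨r • f, by rw [AlgHom.commutes, algebraMap_smul, hl.map_smul]⟩
    | grade1 y =>
      intro f
      cases y with
      | xi i => exact ⟨_, (hXi_smul_toInd ρ κ ε i f).symm⟩
      | eta i => exact ⟨_, (hEta_smul_toInd ρ κ hT hκ hs hε i f).symm⟩
      | grp g => exact ⟨_, (hGrp_smul_toInd ρ κ hε g f).symm⟩
    | mul x y hx hy =>
      intro f
      obtain ⟨f1, h1⟩ := hy f
      obtain ⟨f2, h2⟩ := hx f1
      exact ⟨f2, by rw [h2, h1, map_mul, mul_smul]⟩
    | add x y hx hy =>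
      intro f
      obtain ⟨f1, h1⟩ := hx f
      obtain ⟨f2, h2⟩ := hy f
      exact ⟨f1 + f2, by rw [hl.map_add, h1, h2, map_add, add_smul]⟩
  intro z
  obtain ⟨z, rfl⟩ := Submodule.mkQ_surjective _ z
  induction z using TensorProduct.induction_on with
  | zero => exact ⟨0, by rw [hl.map_zero, map_zero]⟩
  | add z w hz hw =>
    obtain ⟨f, hf⟩ := hz
    obtain ⟨g, hg⟩ := hw
    exact ⟨f + g, by rw [hl.map_add, hf, hg, map_add]⟩
  | tmul x c =>
    obtain ⟨y, rfl⟩ := hMk_surjective ρ κ x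
    obtain ⟨f, hf⟩ := h1 y ((show ℂ from c) • 1)
    refine ⟨f, hf.trans ?_⟩
    rw [hl.map_smul, toInd, map_one, smul_comm, ← indMk_mul, mul_one]
    have h2 : c = (show ℂ from c) • charOne ε := (mul_one (show ℂ from c)).symm
    conv_rhs => rw [h2, TensorProduct.tmul_smul]
    rfl

include hT hκ in
-- The map `x ⊗ c ↦ c • R x 1` descends to the induced module, because `𝔥_η` acts on the constant
-- `1` through `ε`. It sends `f ⊗ 1` back to `f`.
theorem toInd_injective {ε : hSub ρ κ →ₐ[ℂ] ℂ} (hε : IsTrivialChar ρ κ ε) :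
    Function.Injective (toInd ρ κ ε) := by
  have hl := isLinearMap_toInd ρ κ ε
  let R := dunklRep ρ κ hT hκ
  let φ : HO ρ κ ⊗[ℂ] CharModule ε →ₗ[ℂ] Skew n :=
    TensorProduct.lift ((LinearMap.lsmul ℂ (Skew n)).flip ∘ₗ LinearMap.applyₗ (1 : Skew n) ∘ₗ
      R.toLinearMap)
  have hφ : ∀ (x : HO ρ κ) (c : CharModule ε), φ (x ⊗ₜ c) = (show ℂ from c) • R x 1 :=
    fun x c => rfl
  have hφ_smul : ∀ (x : HO ρ κ) z, φ (x • z) = R x (φ z) := by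
    intro x z
    induction z using TensorProduct.induction_on with
    | zero => simp
    | add z w hz hw => rw [smul_add, map_add, hz, hw, map_add, map_add]
    | tmul y c =>
      rw [TensorProduct.smul_tmul', hφ, hφ, smul_eq_mul, map_mul, map_smul, Module.End.mul_apply]
  have hker : ∀ z ∈ indRel (hSub ρ κ) (CharModule ε), φ z = 0 := by
    intro z hz
    induction hz using Submodule.span_induction with
    | zero => simp
    | add z w _ _ hz hw => rw [map_add, hz, hw, add_zero]
    | smul x z _ hz => rw [hφ_smul, hz, map_zero]
    | mem z hz =>
      obtain ⟨x, b, c, rfl⟩ := hz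
      have h1 : R b 1 = ε b • (1 : Skew n) := by
        -- The given `ε` must be the character on constants, so its values can be computed in
        -- `dunklRep`.
        rw [hε.unique (isTrivialChar_dunklChar ρ κ hT hκ), dunklChar_apply]
        exact dunklRep_hSub_one ρ κ hT hκ b.2
      have h2 : (show ℂ from b • c) = ε b * (show ℂ from c) := rfl
      rw [map_sub, hφ, hφ, map_mul, Module.End.mul_apply, h1, map_smul, smul_smul, h2,
        mul_comm, sub_self]
  intro f g hfg
  have h1 := hker _ ((Submodule.Quotient.eq _).1 hfg)
  rw [map_sub, hφ, hφ, dunklRep_skewToHO, dunklRep_skewToHO] at h1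
  have h2 : (show ℂ from charOne ε) = 1 := rfl
  rwa [h2, one_smul, one_smul, sub_eq_zero] at h1

include hκ hs in
theorem inducedRealization_of_dunkl : InducedRealization ρ κ T := by
  refine ⟨⟨_, isTrivialChar_dunklChar ρ κ hT hκ, fun ε h =>
    h.unique (isTrivialChar_dunklChar ρ κ hT hκ)⟩, fun ε hε => ⟨isLinearMap_toInd ρ κ ε,
    ⟨toInd_injective ρ κ hT hκ hε, toInd_surjective ρ κ hT hκ hs hε⟩,
    hGrp_smul_toInd ρ κ hε, hXi_smul_toInd ρ κ ε, hEta_smul_toInd ρ κ hT hκ hs hε⟩,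
    fun i j h f => dunkl_anticomm hT h f⟩

end DunklRep

end Realization

/-! ### The three types -/

theorem rhoB_sB {n : ℕ} (i j : Fin n) : rhoB n (sB i j) = Equiv.swap i j := rfl

theorem rhoB_sbarB {n : ℕ} (i j : Fin n) : rhoB n (sbarB i j) = Equiv.swap i j := rfl

theorem rhoB_tauB {n : ℕ} (i : Fin n) : rhoB n (tauB i) = 1 := rfl

theorem rhoD_sD {n : ℕ} (i j : Fin n) : rhoD n (sD i j) = Equiv.swap i j := rfl

theorem rhoD_sbarD {n : ℕ} (i j : Fin n) : rhoD n (sbarD i j) = Equiv.swap i j := rfl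

theorem fGrp_mem_span {n : ℕ} {G : Type} (g : G) :
    fGrp n g ∈ Submodule.span ℂ (insert 1 (Set.range (fGrp n (G := G)))) :=
  Submodule.subset_span (Or.inr ⟨g, rfl⟩)

theorem one_mem_span_fGrp {n : ℕ} {G : Type} :
    (1 : FreeAlgebra ℂ (HOGen n G)) ∈
      Submodule.span ℂ (insert 1 (Set.range (fGrp n (G := G)))) :=
  Submodule.subset_span (Or.inl rfl)

theorem freeRep_kappaA {n : ℕ} (t u : ℂ) (T : Fin n → Module.End ℂ (Skew n)) (i j : Fin n) :
    freeRep (MonoidHom.id (Equiv.Perm (Fin n))) T (kappaA t u i j) = kappaEnd t u i j := by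
  rw [kappaA, kappaEnd]
  split_ifs
  · simp only [map_add, map_smul, map_sum, map_one, freeRep_fGrp, MonoidHom.id_apply]
  · simp only [map_smul, freeRep_fGrp, MonoidHom.id_apply]

/-- Forgetting signs identifies `s_{ij}` with its barred version, which doubles `u`, and sends `τ_i`
to `1`, which adds `v` to `t`. -/
theorem freeRep_kappaB {n : ℕ} (t u v : ℂ) (T : Fin n → Module.End ℂ (Skew n)) (i j : Fin n) :
    freeRep (rhoB n) T (kappaB t u v i j) = kappaEnd (t + v) (2 * u) i j := by
  rw [kappaB, kappaEnd]
  split_ifs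
  · simp only [map_add, map_smul, map_sum, map_one, freeRep_fGrp, rhoB_sB, rhoB_sbarB, rhoB_tauB,
      ← two_smul ℂ, ← Finset.smul_sum]
    module
  · simp only [map_add, map_smul, freeRep_fGrp, rhoB_sB, rhoB_sbarB]
    module

theorem freeRep_kappaD {n : ℕ} (t u : ℂ) (T : Fin n → Module.End ℂ (Skew n)) (i j : Fin n) :
    freeRep (rhoD n) T (kappaD t u i j) = kappaEnd t (2 * u) i j := by
  rw [kappaD, kappaEnd]
  split_ifs
  · simp only [map_add, map_smul, map_sum, map_one, freeRep_fGrp, rhoD_sD, rhoD_sbarD,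
      ← two_smul ℂ, ← Finset.smul_sum]
    module
  · simp only [map_add, map_smul, freeRep_fGrp, rhoD_sD, rhoD_sbarD]
    module

theorem kappaA_mem_span {n : ℕ} (t u : ℂ) (i j : Fin n) :
    kappaA t u i j ∈ Submodule.span ℂ (insert 1 (Set.range (fGrp n))) := by
  rw [kappaA]
  split_ifs
  · exact add_mem (Submodule.smul_mem _ _ one_mem_span_fGrp)
      (Submodule.smul_mem _ _ (sum_mem fun k _ => fGrp_mem_span _))
  · exact Submodule.smul_mem _ _ (fGrp_mem_span _)

theorem kappaB_mem_span {n : ℕ} (t u v : ℂ) (i j : Fin n) :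
    kappaB t u v i j ∈ Submodule.span ℂ (insert 1 (Set.range (fGrp n))) := by
  rw [kappaB]
  split_ifs
  · exact add_mem (add_mem (Submodule.smul_mem _ _ one_mem_span_fGrp)
      (Submodule.smul_mem _ _ (sum_mem fun k _ => add_mem (fGrp_mem_span _) (fGrp_mem_span _))))
      (Submodule.smul_mem _ _ (fGrp_mem_span _))
  · exact Submodule.smul_mem _ _ (add_mem (fGrp_mem_span _) (fGrp_mem_span _))

theorem kappaD_mem_span {n : ℕ} (t u : ℂ) (i j : Fin n) :
    kappaD t u i j ∈ Submodule.span ℂ (insert 1 (Set.range (fGrp n))) := by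
  rw [kappaD]
  split_ifs
  · exact add_mem (Submodule.smul_mem _ _ one_mem_span_fGrp)
      (Submodule.smul_mem _ _ (sum_mem fun k _ => add_mem (fGrp_mem_span _) (fGrp_mem_span _)))
  · exact Submodule.smul_mem _ _ (add_mem (fGrp_mem_span _) (fGrp_mem_span _))

end

end OddDaha

theorem mainTheorem9 (n : ℕ) (t u v : ℂ) :
    -- the left divisions in the formulas are exact, with a unique quotient
    (∀ (i : Fin n) (f : OddDaha.Skew n),
      ∃! q : OddDaha.Skew n,
        ((2 : ℂ) • OddDaha.xi i) * q = f - OddDaha.act (OddDaha.tauB i) f) ∧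
    (∀ (i k : Fin n), i ≠ k → ∀ f : OddDaha.Skew n,
      ∃! q : OddDaha.Skew n,
        (OddDaha.xi i ^ 2 - OddDaha.xi k ^ 2) * q = OddDaha.dunklNum i k f) ∧
    -- type A
    OddDaha.InducedRealization (MonoidHom.id (Equiv.Perm (Fin n)))
      (OddDaha.kappaA t u) (OddDaha.dunklA t u) ∧
    -- type B
    OddDaha.InducedRealization (OddDaha.rhoB n)
      (OddDaha.kappaB t u v) (OddDaha.dunklB t u v) ∧
    -- type D
    OddDaha.InducedRealization (OddDaha.rhoD n)
      (OddDaha.kappaD t u) (OddDaha.dunklD t u) := by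
  refine ⟨fun i f => ?_, fun i k h f => ?_, ?_, ?_, ?_⟩
  · exact existsUnique_of_exists_of_unique (OddDaha.dvd_sub_act_tauB i f)
      fun p q hp hq => OddDaha.two_xi_mul_cancel (hp.trans hq.symm)
  · exact existsUnique_of_exists_of_unique (OddDaha.dvd_dunklNum h f)
      fun p q hp hq => OddDaha.xi_sq_sub_mul_cancel h (hp.trans hq.symm)
  · exact OddDaha.inducedRealization_of_dunkl _ _ (OddDaha.isSkewDer_dunklA t u)
      (OddDaha.freeRep_kappaA t u _) (OddDaha.kappaA_mem_span t u)
  · exact OddDaha.inducedRealization_of_dunkl _ _ (OddDaha.isSkewDer_dunklB t u v)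
      (OddDaha.freeRep_kappaB t u v _) (OddDaha.kappaB_mem_span t u v)
  · exact OddDaha.inducedRealization_of_dunkl _ _ (OddDaha.isSkewDer_dunklD t u)
      (OddDaha.freeRep_kappaD t u _) (OddDaha.kappaD_mem_span t u)
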